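/- Let $\mathcal A=(Q,T)$ be a strongly connected $d$-dimensional VASS: $Q\neq\emptyset$ is a finite set of states, $T\subseteq Q\times\mathbb Z^d\times Q$ is a finite set of transitions, every state has an outgoing transition, and any two states are joined by a finite path of length at least one. Configurations are pairs $p\mathbf v$ with $p\in Q$, $\mathbf v\in\mathbb N^d$; a transition $(p,\mathbf u,q)$ leads from $p\mathbf v$ to $q(\mathbf v+\mathbf u)$ whenever $\mathbf v+\mathbf u\in\mathbb N^d$. The termination complexity $\mathcal L(n)\in\mathbb N\cup\{\infty\}$ is the supremum of the lengths of all finite computations that start in a configuration $p\mathbf v$ with $\max_i\mathbf v(i)=n$. A quasi-ranking function (QRF) $f$ for a VASS $(Q,T)$ is given by $\mathbf c\in\mathbb Q^d$ with $\mathbf c\ge\mathbf 0$ and $\mathbf w\in\mathbb Q^Q$ such that every transition $(p,\mathbf u,q)\in T$ is either $f$-ranked, i.e. $\mathbf c\cdot\mathbf u+\mathbf w(q)\le\mathbf w(p)-1$, or $f$-neutral, i.e. $\mathbf c\cdot\mathbf u+\mathbf w(q)=\mathbf w(p)$; it is positive if all components of $\mathbf c$ are positive. The procedure Decompose, on a VASS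 $\mathcal B=(Q',T')$, picks a QRF $f$ for $\mathcal B$ that maximizes the number of $f$-ranked transitions and lets $T_f$ be the set of $f$-neutral transitions. If $T_f=T'$ it returns $\infty$; if $T_f=\emptyset$ it returns $1$; otherwise it returns $1+\max_i \mathrm{Decompose}(\mathcal B_i)$, where the $\mathcal B_i$ are all strongly connected components of $(Q',T_f)$, that is, the maximal strongly connected VASS contained in $(Q',T_f)$. The algorithm, on input $\mathcal A$, sets $\mathit{tight}$ to true if $\mathcal A$ has a positive QRF and to false otherwise, and computes $k=\mathrm{Decompose}(\mathcal A)$; if $k=\infty$ it returns "non-terminating", otherwise it returns the pair $(k,\mathit{tight})$. **Theorem.** If the algorithm, run on $\mathcal A$, returns a pair $(k,\mathit{tight})\in\mathbb N\times\{\mathrm{true},\mathrm{false}\}$, then $k\in\{1,\dots,d\}$ and $\mathcal L(n)\in\Omega(n^k)$, where $\Omega(n^k)$ is the set of all $g:\mathbb N\to\mathbb N$ for which there is a real $b>0$ with $g(n)\ge b\,n^k$ for all sufficiently large $n$; in particular $\mathcal L(n)$ is finite for every $n$. This holds whether $\mathit{tight}$ is true or false. -/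

import Mathlib

/-- A transition `(p, u, q)` of a `d`-dimensional VASS with states taken from `σ`. -/
abbrev VTransition (σ : Type*) (d : ℕ) : Type _ := σ × (Fin d → ℤ) × σ

/-- A `d`-dimensional vector addition system with states `(Q, T)`: `Q` is a non-empty finite set of
states, `T ⊆ Q × ℤ^d × Q` is finite, and every state has an outgoing transition. -/
structure VASS (σ : Type*) (d : ℕ) where
  states : Finset σ
  trans : Finset (VTransition σ d)
  states_nonempty : states.Nonempty
  src_mem : ∀ t ∈ trans, t.1 ∈ states
  tgt_mem : ∀ t ∈ trans, t.2.2 ∈ states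
  exists_out : ∀ p ∈ states, ∃ u q, (p, u, q) ∈ trans

namespace VASS

/-- `B ≤ A` means that `B` is a sub-VASS of `A`. -/
instance {σ : Type*} {d : ℕ} : LE (VASS σ d) :=
  ⟨fun B A => B.states ⊆ A.states ∧ B.trans ⊆ A.trans⟩

/-- Every two states are joined by a finite path, of length at least one. -/
def StronglyConnected {σ : Type*} {d : ℕ} (A : VASS σ d) : Prop :=
  ∀ p ∈ A.states, ∀ q ∈ A.states, Relation.TransGen (fun x y => ∃ u, (x, u, y) ∈ A.trans) p q

/-- `B` is a strongly connected component of the pair `(Q, T)` (which need not be a VASS):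
a maximal strongly connected VASS contained in `(Q, T)`. -/
def IsSCC {σ : Type*} {d : ℕ} (Q : Finset σ) (T : Finset (VTransition σ d)) (B : VASS σ d) : Prop :=
  Maximal (fun C : VASS σ d => C.StronglyConnected ∧ C.states ⊆ Q ∧ C.trans ⊆ T) B

/-! ### Computations and termination complexity -/

/-- One step of a computation, between vectors of non-negative counter values. -/
def Step {σ : Type*} {d : ℕ} (A : VASS σ d) (c c' : σ × (Fin d → ℕ)) : Prop :=
  ∃ u, (c.1, u, c'.1) ∈ A.trans ∧ ∀ i, (c'.2 i : ℤ) = (c.2 i : ℤ) + u i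

/-- There is a computation of length `n` initiated in `c`. -/
def HasComputation {σ : Type*} {d : ℕ} (A : VASS σ d) (c : σ × (Fin d → ℕ)) (n : ℕ) : Prop :=
  ∃ γ : Fin (n + 1) → σ × (Fin d → ℕ), γ 0 = c ∧ ∀ i : Fin n, A.Step (γ i.castSucc) (γ i.succ)

/-- The least element of `ℕ ∪ {∞}` bounding the length of every computation initiated in `c`. -/
noncomputable def maxLength {σ : Type*} {d : ℕ} (A : VASS σ d) (c : σ × (Fin d → ℕ)) : ℕ∞ :=
  ⨆ (n : ℕ) (_ : A.HasComputation c n), (n : ℕ∞)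

/-- The size of a vector of counter values: its greatest component. -/
def size {d : ℕ} (v : Fin d → ℕ) : ℕ := Finset.univ.sup v

/-- The termination complexity of `A`: the supremum of the lengths of the computations initiated in
configurations of size `n`. -/
noncomputable def termComplexity {σ : Type*} {d : ℕ} (A : VASS σ d) (n : ℕ) : ℕ∞ :=
  ⨆ (c : σ × (Fin d → ℕ)) (_ : c.1 ∈ A.states ∧ size c.2 = n), A.maxLength c

end VASS

/-! ### Quasi-ranking functions -/

/-- A linear map `p v ↦ c · v + w p` on configurations, with normal `c` and weights `w`. -/
structure VLinearMap (σ : Type*) (d : ℕ) where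
  c : Fin d → ℚ
  w : σ → ℚ

namespace VLinearMap

/-- The transition `(p, u, q)` is `f`-ranked if `c · u + w q ≤ w p - 1`. -/
def Ranks {σ : Type*} {d : ℕ} (f : VLinearMap σ d) (t : VTransition σ d) : Prop :=
  (∑ i, f.c i * (t.2.1 i : ℚ)) + f.w t.2.2 ≤ f.w t.1 - 1

/-- The transition `(p, u, q)` is `f`-neutral if `c · u + w q = w p`. -/
def Neutral {σ : Type*} {d : ℕ} (f : VLinearMap σ d) (t : VTransition σ d) : Prop :=
  (∑ i, f.c i * (t.2.1 i : ℚ)) + f.w t.2.2 = f.w t.1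

/-- `f` is a quasi-ranking function for `A`. -/
def IsQRF {σ : Type*} {d : ℕ} (f : VLinearMap σ d) (A : VASS σ d) : Prop :=
  (∀ i, 0 ≤ f.c i) ∧ ∀ t ∈ A.trans, f.Ranks t ∨ f.Neutral t

open Classical in
/-- The finite set of `f`-ranked transitions of `A`. -/
noncomputable def ranked {σ : Type*} {d : ℕ} (f : VLinearMap σ d) (A : VASS σ d) :
    Finset (VTransition σ d) :=
  A.trans.filter (fun t => f.Ranks t)

open Classical in
/-- The finite set `T_f` of `f`-neutral transitions of `A`. -/
noncomputable def neutral {σ : Type*} {d : ℕ} (f : VLinearMap σ d) (A : VASS σ d) :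
    Finset (VTransition σ d) :=
  A.trans.filter (fun t => f.Neutral t)

/-- `f` is a quasi-ranking function for `A` maximizing the number of `f`-ranked transitions. -/
def IsMaxQRF {σ : Type*} {d : ℕ} (f : VLinearMap σ d) (A : VASS σ d) : Prop :=
  f.IsQRF A ∧ ∀ g : VLinearMap σ d, g.IsQRF A → (g.ranked A).card ≤ (f.ranked A).card

end VLinearMap

/-- There is a quasi-ranking function for `A` all components of whose normal are positive. -/
def VASS.HasPositiveQRF {σ : Type*} {d : ℕ} (A : VASS σ d) : Prop :=
  ∃ f : VLinearMap σ d, f.IsQRF A ∧ ∀ i, 0 < f.c i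

/-! ### The algorithm -/

/-- `Decompose A k`: some run of the recursive procedure `Decompose` on input `A` returns `k`.
The procedure picks any quasi-ranking function `f` maximizing the number of `f`-ranked transitions.
It returns `∞` if all transitions are `f`-neutral and `1` if none is; otherwise it calls itself on
all strongly connected components `B` of `(Q, T_f)`, with results `r B`, and returns
`1 + max_B (r B)`. -/
inductive Decompose {σ : Type*} {d : ℕ} : VASS σ d → ℕ∞ → Prop
  | infinite (A : VASS σ d) (f : VLinearMap σ d) (hf : f.IsMaxQRF A)
      (hall : f.neutral A = A.trans) : Decompose A ⊤
  | one (A : VASS σ d) (f : VLinearMap σ d) (hf : f.IsMaxQRF A)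
      (hall : f.neutral A ≠ A.trans) (hnone : f.neutral A = ∅) : Decompose A 1
  | recurse (A : VASS σ d) (f : VLinearMap σ d) (hf : f.IsMaxQRF A)
      (hall : f.neutral A ≠ A.trans) (hnone : f.neutral A ≠ ∅)
      (r : VASS σ d → ℕ∞)
      (hr : ∀ B, VASS.IsSCC A.states (f.neutral A) B → Decompose B (r B)) :
      Decompose A (1 + ⨆ (B : VASS σ d) (_ : VASS.IsSCC A.states (f.neutral A) B), r B)

/-- The possible outputs of the algorithm. -/
inductive AlgOutput
  | nonTerminating : AlgOutput
  | bound (k : ℕ) (tight : Bool) : AlgOutput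

/-- `AlgReturns A o`: some run of the algorithm on input `A` returns the output `o`. -/
inductive AlgReturns {σ : Type*} {d : ℕ} (A : VASS σ d) : AlgOutput → Prop
  | nonTerminating (h : Decompose A ⊤) : AlgReturns A AlgOutput.nonTerminating
  | bound (k : ℕ) (tight : Bool) (htight : tight = true ↔ A.HasPositiveQRF)
      (h : Decompose A (k : ℕ∞)) : AlgReturns A (AlgOutput.bound k tight)

/-- `Ω(f)`: the set of all `g : ℕ → ℕ` such that, for some real `b > 0`, `g n ≥ b * f n` for all
sufficiently large `n`. -/
def bigOmega (f : ℕ → ℕ) : Set (ℕ → ℕ) :=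
  {g | ∃ b : ℝ, 0 < b ∧ ∀ᶠ n : ℕ in Filter.atTop, b * (f n : ℝ) ≤ (g n : ℝ)}

/-! Lower bound. The invariant `HasLongWalks A k` is proved by induction on the recursion of
`Decompose`. It provides closed walks `τ` at a state `q` of length at least `n ^ k`, executable from
counters linear in `n`, whose effect is at least `n` times that of a fixed closed walk `r`. Suppose
it holds for a component `B` of the neutral part of `A`. Since `r` uses neutral transitions only,
maximality of the quasi-ranking function and Farkas' lemma yield closed walks of `A` with total
effect `e` such that `walkEffect r + e ≥ 0` (`exists_compensation`): a separating vector would give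
a quasi-ranking function with more ranked transitions. By strong connectivity a closed walk `θ` at
`q` of length linear in `n` has effect `n • e` plus a constant, the effect of a closed walk `κ`
(`exists_pump`). One round `τ ++ θ` thus loses at most a constant, and `n` rounds from linear
counters give exponent `k + 1`, with `κ` in the role of `r` (`HasLongWalks.succ`). Bound `k ≤ d`.
The span of the effects of closed walks loses dimension at each recursive call, because the normal
of the quasi-ranking function vanishes on the component but not on `A` (`le_finrank`). Finiteness. A
nonempty closed walk of non-negative effect stays neutral at every level, which forces the result
`∞` (`eq_top_of_closed`). Without such walks Dickson's lemma excludes infinite computations, and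
finite branching bounds the finite ones. -/

/-! ### Farkas' lemma -/

/-- **Farkas' lemma** for finitely many linear functionals over an ordered field: a functional that
is non-positive wherever all `a i` are is a non-negative combination of the `a i`. -/
theorem farkas_functionals {K V ι : Type*} [Field K] [LinearOrder K] [IsStrictOrderedRing K]
    [AddCommGroup V] [Module K V] (s : Finset ι) :
    ∀ (a : ι → V →ₗ[K] K) (b : V →ₗ[K] K), (∀ x, (∀ i ∈ s, a i x ≤ 0) → b x ≤ 0) →
      ∃ l : ι → K, (∀ i, 0 ≤ l i) ∧ b = ∑ i ∈ s, l i • a i := by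
  classical
  induction s using Finset.induction_on with
  | empty =>
    intro a b h
    refine ⟨0, fun _ => le_rfl, ?_⟩
    ext x
    have h1 := h x (by simp)
    have h2 := h (-x) (by simp)
    rw [map_neg] at h2
    simp only [Finset.sum_empty, LinearMap.zero_apply]
    linarith
  | insert j s hj ih =>
    intro a b h
    by_cases h0 : ∀ x, (∀ i ∈ s, a i x ≤ 0) → b x ≤ 0
    · obtain ⟨l, hl, hb⟩ := ih a b h0
      refine ⟨Function.update l j 0, fun i => ?_, ?_⟩
      · by_cases hi : i = j
        · subst hi; simp
        · simpa [hi] using hl i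
      · rw [Finset.sum_insert hj, hb]
        simp only [Function.update_self, zero_smul, zero_add]
        refine Finset.sum_congr rfl fun i hi => ?_
        rw [Function.update_of_ne (ne_of_mem_of_not_mem hi hj)]
    · push Not at h0
      obtain ⟨x, hx, hbx⟩ := h0
      have hjx : 0 < a j x := by
        by_contra hc
        exact absurd (h x fun i hi => by
          rcases Finset.mem_insert.1 hi with rfl | hi
          · exact not_lt.1 hc
          · exact hx i hi) (not_le.2 hbx)
      -- Composition with the projection along `x` onto the kernel of `a j` removes `a j` from the
      -- family. The coefficient of `a j` recovered below is non-negative because `b x > 0` and `a i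
      -- x ≤ 0` on `s`.
      obtain ⟨l, hl, hb⟩ := ih (fun i => a i - (a i x / a j x) • a j)
        (b - (b x / a j x) • a j) (by
          intro y hy
          have := h (y - (a j y / a j x) • x) (by
            intro i hi
            rcases Finset.mem_insert.1 hi with rfl | hi
            · simp [div_mul_cancel₀ _ hjx.ne']
            · have := hy i hi
              simp only [LinearMap.sub_apply, LinearMap.smul_apply, smul_eq_mul, map_sub,
                map_smul] at this ⊢
              calc _ = _ := by ring
                _ ≤ 0 := this)
          simp only [LinearMap.sub_apply, LinearMap.smul_apply, smul_eq_mul, map_sub,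
            map_smul] at this ⊢
          calc _ = _ := by ring
            _ ≤ 0 := this)
      refine ⟨Function.update l j (b x / a j x - ∑ i ∈ s, l i * (a i x / a j x)), fun i => ?_, ?_⟩
      · by_cases hi : i = j
        · subst hi
          simp only [Function.update_self]
          have h1 : 0 ≤ b x / a i x := by positivity
          have h2 : ∑ i' ∈ s, l i' * (a i' x / a i x) ≤ 0 := Finset.sum_nonpos fun k hk =>
            mul_nonpos_of_nonneg_of_nonpos (hl k) (div_nonpos_of_nonpos_of_nonneg (hx k hk) hjx.le)
          linarith
        · simpa [hi] using hl i
      · rw [Finset.sum_insert hj, Function.update_self,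
          Finset.sum_congr rfl (g := fun i => l i • a i) fun i hi => by
            rw [Function.update_of_ne (ne_of_mem_of_not_mem hi hj)]]
        rw [sub_eq_iff_eq_add] at hb
        refine hb.trans ?_
        ext y
        simp only [LinearMap.add_apply, LinearMap.sub_apply, LinearMap.smul_apply, smul_eq_mul,
          LinearMap.sum_apply, mul_sub, sub_mul, Finset.sum_sub_distrib, Finset.sum_mul, mul_assoc]
        ring

/-! ### Walks -/

section Walks

variable {σ : Type*} {d : ℕ}

/-- `l` is the list of transitions of a walk from `p` to `q` in the graph with edges `T`. -/
def IsWalk (T : Finset (VTransition σ d)) : σ → List (VTransition σ d) → σ → Prop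
  | p, [], q => p = q
  | p, t :: l, q => t ∈ T ∧ t.1 = p ∧ IsWalk T t.2.2 l q

/-- The total effect of a list of transitions. -/
def walkEffect (l : List (VTransition σ d)) : Fin d → ℤ := (l.map fun t => t.2.1).sum

@[simp] theorem walkEffect_nil : walkEffect ([] : List (VTransition σ d)) = 0 := rfl

@[simp] theorem walkEffect_cons (t : VTransition σ d) (l : List (VTransition σ d)) :
    walkEffect (t :: l) = t.2.1 + walkEffect l := by simp [walkEffect]

@[simp] theorem walkEffect_append (l m : List (VTransition σ d)) :
    walkEffect (l ++ m) = walkEffect l + walkEffect m := by simp [walkEffect]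

theorem isWalk_append {T : Finset (VTransition σ d)} {p r : σ} {l m : List (VTransition σ d)} :
    IsWalk T p (l ++ m) r ↔ ∃ q, IsWalk T p l q ∧ IsWalk T q m r := by
  induction l generalizing p with
  | nil => simp [IsWalk]
  | cons t l ih => simp [IsWalk, ih, and_assoc]

theorem IsWalk.append {T : Finset (VTransition σ d)} {p q r : σ} {l m : List (VTransition σ d)}
    (hl : IsWalk T p l q) (hm : IsWalk T q m r) : IsWalk T p (l ++ m) r :=
  isWalk_append.2 ⟨q, hl, hm⟩

theorem IsWalk.target_unique {T : Finset (VTransition σ d)} {p q r : σ}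
    {l : List (VTransition σ d)} (hq : IsWalk T p l q) (hr : IsWalk T p l r) : q = r := by
  induction l generalizing p with
  | nil => exact hq.symm.trans hr
  | cons t l ih => exact ih hq.2.2 hr.2.2

theorem IsWalk.mono {T T' : Finset (VTransition σ d)} (hT : T ⊆ T') {p q : σ}
    {l : List (VTransition σ d)} (hl : IsWalk T p l q) : IsWalk T' p l q := by
  induction l generalizing p with
  | nil => exact hl
  | cons t l ih => exact ⟨hT hl.1, hl.2.1, ih hl.2.2⟩

theorem IsWalk.mem {T : Finset (VTransition σ d)} {p q : σ} {l : List (VTransition σ d)}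
    (hl : IsWalk T p l q) : ∀ t ∈ l, t ∈ T := by
  induction l generalizing p with
  | nil => simp
  | cons t l ih =>
    intro s hs
    rcases List.mem_cons.1 hs with rfl | hs
    · exact hl.1
    · exact ih hl.2.2 s hs

theorem IsWalk.of_mem {T T' : Finset (VTransition σ d)} {p q : σ} {l : List (VTransition σ d)}
    (hl : IsWalk T p l q) (h : ∀ t ∈ l, t ∈ T') : IsWalk T' p l q := by
  induction l generalizing p with
  | nil => exact hl
  | cons t l ih =>
    exact ⟨h t (by simp), hl.2.1, ih hl.2.2 fun s hs => h s (by simp [hs])⟩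

/-- The `n`-fold repetition of a list. -/
def repeatList {α : Type*} (n : ℕ) (l : List α) : List α := (List.replicate n l).flatten

theorem repeatList_succ {α : Type*} (n : ℕ) (l : List α) :
    repeatList (n + 1) l = l ++ repeatList n l := by simp [repeatList, List.replicate_succ]

@[simp] theorem repeatList_zero {α : Type*} (l : List α) : repeatList 0 l = [] := rfl

@[simp] theorem length_repeatList {α : Type*} (n : ℕ) (l : List α) :
    (repeatList n l).length = n * l.length := by simp [repeatList]

theorem IsWalk.repeatList {T : Finset (VTransition σ d)} {p : σ} {l : List (VTransition σ d)}
    (hl : IsWalk T p l p) (n : ℕ) : IsWalk T p (repeatList n l) p := by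
  induction n with
  | zero => rfl
  | succ n ih => rw [repeatList_succ]; exact hl.append ih

@[simp] theorem walkEffect_repeatList (n : ℕ) (l : List (VTransition σ d)) :
    walkEffect (repeatList n l) = n • walkEffect l := by
  induction n with
  | zero => simp
  | succ n ih => rw [repeatList_succ, walkEffect_append, ih, succ_nsmul']

theorem IsWalk.target_mem {A : VASS σ d} {p q : σ} {l : List (VTransition σ d)}
    (hl : IsWalk A.trans p l q) (hp : p ∈ A.states) : q ∈ A.states := by
  induction l generalizing p with
  | nil => exact hl ▸ hp
  | cons t l ih => exact ih hl.2.2 (A.tgt_mem t hl.1)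

theorem exists_isWalk_of_transGen {T : Finset (VTransition σ d)} {p q : σ}
    (h : Relation.TransGen (fun x y => ∃ u, (x, u, y) ∈ T) p q) :
    ∃ l, l ≠ [] ∧ IsWalk T p l q := by
  induction h with
  | single h =>
    obtain ⟨u, hu⟩ := h
    exact ⟨[(p, u, _)], by simp, hu, rfl, rfl⟩
  | tail _ h ih =>
    obtain ⟨u, hu⟩ := h
    obtain ⟨l, -, hl⟩ := ih
    exact ⟨l ++ [(_, u, _)], by simp, hl.append ⟨hu, rfl, rfl⟩⟩

theorem IsWalk.transGen {T : Finset (VTransition σ d)} {p q : σ} {l : List (VTransition σ d)}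
    (hl : IsWalk T p l q) (hne : l ≠ []) :
    Relation.TransGen (fun x y => ∃ u, (x, u, y) ∈ T) p q := by
  induction l generalizing p with
  | nil => exact absurd rfl hne
  | cons t l ih =>
    obtain ⟨ht, rfl, hl⟩ := hl
    have h1 : ∃ u, (t.1, u, t.2.2) ∈ T := ⟨t.2.1, ht⟩
    by_cases h : l = []
    · subst h
      obtain rfl : t.2.2 = q := hl
      exact .single h1
    · exact .head h1 (ih hl h)

theorem VASS.StronglyConnected.exists_walk {A : VASS σ d} (hA : A.StronglyConnected) {p q : σ}
    (hp : p ∈ A.states) (hq : q ∈ A.states) : ∃ l, l ≠ [] ∧ IsWalk A.trans p l q :=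
  exists_isWalk_of_transGen (hA p hp q hq)

/-- A linear potential telescopes along a walk. -/
theorem IsWalk.sum_slack {T : Finset (VTransition σ d)} {p q : σ} {l : List (VTransition σ d)}
    (hl : IsWalk T p l q) (f : VLinearMap σ d) :
    (l.map fun t => (∑ i, f.c i * (t.2.1 i : ℚ)) + f.w t.2.2 - f.w t.1).sum =
      (∑ i, f.c i * (walkEffect l i : ℚ)) + f.w q - f.w p := by
  induction l generalizing p with
  | nil => obtain rfl : p = q := hl; simp
  | cons t l ih =>
    obtain ⟨-, rfl, hl⟩ := hl
    rw [List.map_cons, List.sum_cons, ih hl]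
    simp only [walkEffect_cons, Pi.add_apply, Int.cast_add, mul_add, Finset.sum_add_distrib]
    ring

/-! ### Short closed walks -/

/-- If a walk is longer than the number of states then it contains a proper closed subwalk. -/
theorem IsWalk.exists_cycle {A : VASS σ d} {p q : σ} {l : List (VTransition σ d)}
    (hl : IsWalk A.trans p l q) (hp : p ∈ A.states) (hlen : A.states.card < l.length) :
    ∃ r l₁ l₂ l₃, l = l₁ ++ (l₂ ++ l₃) ∧ l₂ ≠ [] ∧ l₂.length ≤ A.states.card ∧
      IsWalk A.trans p l₁ r ∧ IsWalk A.trans r l₂ r ∧ IsWalk A.trans r l₃ q := by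
  have hst : ∀ i, ∃ r, IsWalk A.trans p (l.take i) r ∧ IsWalk A.trans r (l.drop i) q := fun i =>
    isWalk_append.1 (by rwa [List.take_append_drop])
  choose st h1 h2 using hst
  have hmem : ∀ i, st i ∈ A.states := fun i => (h1 i).target_mem hp
  -- The pigeonhole is applied only to the first `card + 1` positions, so the cycle found is short.
  obtain ⟨i, hi, j, hj, hij, hsij⟩ := Finset.exists_ne_map_eq_of_card_lt_of_maps_to
    (s := Finset.range (A.states.card + 1)) (t := A.states) (by simp) (f := st)
    (fun i _ => hmem i)
  wlog hlt : i < j generalizing i j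
  · exact this j hj i hi hij.symm hsij.symm (by omega)
  rw [Finset.mem_range] at hi hj
  have hsplit : l.drop i = (l.drop i).take (j - i) ++ l.drop j := by
    conv_lhs => rw [← List.take_append_drop (j - i) (l.drop i)]
    rw [List.drop_drop]; congr 2; omega
  refine ⟨st i, l.take i, (l.drop i).take (j - i), l.drop j, ?_, ?_, ?_, h1 i, ?_, ?_⟩
  · rw [← hsplit, List.take_append_drop]
  · intro h
    have := congrArg List.length h
    simp at this
    omega
  · simp; omega
  · have h3 := h1 j
    rw [show j = i + (j - i) by omega, List.take_add, isWalk_append] at h3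
    obtain ⟨s, hs1, hs2⟩ := h3
    obtain rfl := hs1.target_unique (h1 i)
    rwa [show i + (j - i) = j by omega, ← hsij] at hs2
  · rw [hsij]; exact h2 j

end Walks

/-! ### Compensating closed walks -/

/-- Clears denominators, both in the Farkas coefficients and in a separating vector. -/
theorem exists_common_denominator {ι : Type*} (s : Finset ι) (r : ι → ℚ) :
    ∃ N : ℕ, 0 < N ∧ ∀ i ∈ s, ∃ z : ℤ, (N : ℚ) * r i = z := by
  refine ⟨∏ i ∈ s, (r i).den, Finset.prod_pos fun i _ => (r i).den_pos, fun i hi => ?_⟩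
  obtain ⟨m, hm⟩ := Finset.dvd_prod_of_mem (fun i => (r i).den) hi
  refine ⟨m * (r i).num, ?_⟩
  rw [hm]
  push_cast
  rw [mul_right_comm, Rat.den_mul_eq_num, mul_comm]

section Compensation

variable {σ : Type*} {d : ℕ}

/-- Closed walks have non-positive weight as soon as the short ones do. -/
theorem closed_walk_weight_nonpos {A : VASS σ d} (φ : (Fin d → ℤ) →+ ℤ)
    (h : ∀ p ∈ A.states, ∀ l, IsWalk A.trans p l p → l.length ≤ A.states.card →
      φ (walkEffect l) ≤ 0) :
    ∀ p ∈ A.states, ∀ l, IsWalk A.trans p l p → φ (walkEffect l) ≤ 0 := by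
  intro p hp l hl
  induction hn : l.length using Nat.strong_induction_on generalizing l with
  | _ n ih =>
    subst hn
    by_cases hlen : l.length ≤ A.states.card
    · exact h p hp l hl hlen
    -- Excising the short cycle `l₂` leaves the shorter closed walk `l₁ ++ l₃`.
    obtain ⟨r, l₁, l₂, l₃, rfl, hne, hlen₂, h₁, h₂, h₃⟩ := hl.exists_cycle hp (not_le.1 hlen)
    have e1 := h r (h₁.target_mem hp) l₂ h₂ hlen₂
    have e2 := ih (l₁ ++ l₃).length (by
      have := List.length_pos_iff.2 hne
      simp; omega) (l₁ ++ l₃) (h₁.append h₃) rfl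
    simp only [walkEffect_append, map_add] at e2 ⊢
    linarith

/-- If no closed walk has positive weight then the weights have a potential. -/
theorem VASS.StronglyConnected.exists_potential {A : VASS σ d} (hA : A.StronglyConnected)
    (φ : (Fin d → ℤ) →+ ℤ)
    (h : ∀ p ∈ A.states, ∀ l, IsWalk A.trans p l p → φ (walkEffect l) ≤ 0) :
    ∃ w : σ → ℤ, ∀ t ∈ A.trans, φ t.2.1 + w t.2.2 ≤ w t.1 := by
  obtain ⟨p₀, hp₀⟩ := A.states_nonempty
  -- The potential of `p` is the largest weight of a walk from `p` to `p₀`; it is finite because a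
  -- fixed walk from `p₀` to `p` closes each of them.
  let S : σ → Set ℤ := fun p => {z | ∃ l, IsWalk A.trans p l p₀ ∧ φ (walkEffect l) = z}
  have hne : ∀ p ∈ A.states, (S p).Nonempty := fun p hp => by
    obtain ⟨l, -, hl⟩ := hA.exists_walk hp hp₀
    exact ⟨_, l, hl, rfl⟩
  have hbdd : ∀ p ∈ A.states, BddAbove (S p) := fun p hp => by
    obtain ⟨m, -, hm⟩ := hA.exists_walk hp₀ hp
    refine ⟨-φ (walkEffect m), ?_⟩
    rintro _ ⟨l, hl, rfl⟩
    have := h p₀ hp₀ _ (hm.append hl)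
    simp only [walkEffect_append, map_add] at this
    linarith
  refine ⟨fun p => sSup (S p), fun t ht => ?_⟩
  obtain ⟨l, hl, he⟩ := Int.csSup_mem (hne _ (A.tgt_mem t ht)) (hbdd _ (A.tgt_mem t ht))
  dsimp only
  rw [← he]
  exact le_csSup (hbdd _ (A.src_mem t ht)) ⟨t :: l, ⟨ht, rfl, hl⟩, by simp⟩

/-- The additive monoid generated by the effects of the closed walks of `A`. -/
def VASS.cycleEffects (A : VASS σ d) : AddSubmonoid (Fin d → ℤ) :=
  AddSubmonoid.closure {e | ∃ p ∈ A.states, ∃ l, IsWalk A.trans p l p ∧ walkEffect l = e}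

theorem VASS.walkEffect_mem_cycleEffects {A : VASS σ d} {p : σ} (hp : p ∈ A.states)
    {l : List (VTransition σ d)} (hl : IsWalk A.trans p l p) : walkEffect l ∈ A.cycleEffects :=
  AddSubmonoid.subset_closure ⟨p, hp, l, hl, rfl⟩

/-- Keeps the family of functionals finite, as `farkas_functionals` requires. -/
theorem VASS.finite_short_closed_walks (A : VASS σ d) (N : ℕ) :
    {l | (∃ p ∈ A.states, IsWalk A.trans p l p) ∧ l.length ≤ N}.Finite := by
  refine ((List.finite_length_le A.trans N).image (List.map Subtype.val)).subset ?_
  rintro l ⟨⟨p, -, hl⟩, hlen⟩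
  refine ⟨l.attach.map fun t => ⟨t.1, hl.mem t.1 t.2⟩, by simpa using hlen, ?_⟩
  rw [List.map_map]
  exact List.attach_map_subtype_val l

/-- Adding to a quasi-ranking function an integral map that never increases. -/
theorem VLinearMap.IsMaxQRF.neutral_of_integral {A : VASS σ d} {f : VLinearMap σ d}
    (hf : f.IsMaxQRF A) (c : Fin d → ℤ) (w : σ → ℤ) (hc : ∀ i, 0 ≤ c i)
    (hw : ∀ t ∈ A.trans, ∑ i, c i * t.2.1 i + w t.2.2 ≤ w t.1) :
    ∀ t ∈ f.neutral A, ∑ i, c i * t.2.1 i + w t.2.2 = w t.1 := by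
  classical
  intro t₀ ht₀
  by_contra hne
  simp only [VLinearMap.neutral, Finset.mem_filter] at ht₀
  -- By integrality a strict decrease is a decrease by at least 1. Hence `g` ranks all that `f`
  -- ranks and also `t₀`, against maximality.
  let g : VLinearMap σ d := ⟨fun i => f.c i + c i, fun p => f.w p + w p⟩
  have key : ∀ t ∈ A.trans, (f.Ranks t → g.Ranks t) ∧
      (f.Neutral t → ∑ i, c i * t.2.1 i + w t.2.2 ≠ w t.1 → g.Ranks t) ∧
      (f.Neutral t → ∑ i, c i * t.2.1 i + w t.2.2 = w t.1 → g.Neutral t) := by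
    intro t ht
    have h1 := hw t ht
    have hcast : ((∑ i, c i * t.2.1 i : ℤ) : ℚ) = ∑ i, (c i : ℚ) * (t.2.1 i : ℚ) := by push_cast; rfl
    have hsum : (∑ i, (f.c i + (c i : ℚ)) * (t.2.1 i : ℚ)) =
        (∑ i, f.c i * (t.2.1 i : ℚ)) + ((∑ i, c i * t.2.1 i : ℤ) : ℚ) := by
      rw [hcast, ← Finset.sum_add_distrib]
      exact Finset.sum_congr rfl fun i _ => add_mul _ _ _
    simp only [VLinearMap.Ranks, VLinearMap.Neutral, g, hsum]
    generalize (∑ i, c i * t.2.1 i) = z at *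
    refine ⟨fun h => ?_, fun h h' => ?_, fun h h' => ?_⟩
    · have h2 : (z : ℚ) + w t.2.2 ≤ w t.1 := by exact_mod_cast h1
      linarith
    · have h2 : (z : ℚ) + w t.2.2 ≤ w t.1 - 1 := by
        have : z + w t.2.2 ≤ w t.1 - 1 := by omega
        exact_mod_cast this
      linarith
    · have h2 : (z : ℚ) + w t.2.2 = w t.1 := by exact_mod_cast h'
      linarith
  have hg : g.IsQRF A := by
    refine ⟨fun i => add_nonneg (hf.1.1 i) (by exact_mod_cast hc i), fun t ht => ?_⟩
    obtain ⟨k1, k2, k3⟩ := key t ht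
    rcases hf.1.2 t ht with h | h
    · exact .inl (k1 h)
    · by_cases h' : ∑ i, c i * t.2.1 i + w t.2.2 = w t.1
      · exact .inr (k3 h h')
      · exact .inl (k2 h h')
  refine absurd (hf.2 g hg) (not_le.2 (Finset.card_lt_card ⟨fun t ht => ?_, fun hsub => ?_⟩))
  · simp only [VLinearMap.ranked, Finset.mem_filter] at ht ⊢
    exact ⟨ht.1, (key t ht.1).1 ht.2⟩
  · have : t₀ ∈ f.ranked A := hsub (by
      simp only [VLinearMap.ranked, Finset.mem_filter]
      exact ⟨ht₀.1, (key t₀ ht₀.1).2.1 ht₀.2 hne⟩)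
    simp only [VLinearMap.ranked, Finset.mem_filter] at this
    have h1 := this.2
    have h2 := ht₀.2
    simp only [VLinearMap.Ranks, VLinearMap.Neutral] at h1 h2
    linarith

/-- The linear functional `x ↦ v · x`. -/
def dotFunctional (v : Fin d → ℤ) : (Fin d → ℚ) →ₗ[ℚ] ℚ := ∑ i, (v i : ℚ) • LinearMap.proj i

@[simp] theorem dotFunctional_apply (v : Fin d → ℤ) (x : Fin d → ℚ) :
    dotFunctional v x = ∑ i, (v i : ℚ) * x i := by simp [dotFunctional]

/-- A closed walk on neutral transitions of a maximal quasi-ranking function is compensated by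
closed walks of the whole VASS. -/
theorem VLinearMap.IsMaxQRF.exists_compensation {A : VASS σ d} (hA : A.StronglyConnected)
    {f : VLinearMap σ d} (hf : f.IsMaxQRF A) {q : σ} (hq : q ∈ A.states)
    {r : List (VTransition σ d)} (hr : IsWalk (f.neutral A) q r q) :
    ∃ e ∈ A.cycleEffects, 0 ≤ walkEffect r + e := by
  classical
  have hrA : IsWalk A.trans q r q := hr.mono (Finset.filter_subset _ _)
  let S := (A.finite_short_closed_walks A.states.card).toFinset
  have hS : ∀ l, l ∈ S ↔ (∃ p ∈ A.states, IsWalk A.trans p l p) ∧ l.length ≤ A.states.card :=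
    fun l => by simp [S]
  let a : List (VTransition σ d) ⊕ Fin d → ((Fin d → ℚ) →ₗ[ℚ] ℚ) :=
    Sum.elim (fun l => dotFunctional (walkEffect l)) (fun i => -LinearMap.proj i)
  -- Either the effect of `r` plus a non-negative combination of short closed walks is non-negative,
  -- or some `x ≥ 0` is non-positive on all short closed walks and negative on `r`.
  by_cases hfar : ∀ x, (∀ i ∈ S.disjSum Finset.univ, a i x ≤ 0) →
      (-dotFunctional (walkEffect r)) x ≤ 0
  · obtain ⟨l, hl0, hl⟩ := farkas_functionals _ a _ hfar
    obtain ⟨N, hN, hz⟩ := exists_common_denominator S fun m => l (.inl m)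
    choose! z hz using hz
    have hz0 : ∀ m ∈ S, 0 ≤ z m := fun m hm => by
      have : (0 : ℚ) ≤ z m := by rw [← hz m hm]; exact mul_nonneg (by positivity) (hl0 _)
      exact_mod_cast this
    -- Scaling by `N` produces `N` copies of `r`; one is the given walk, the others belong to `e`.
    refine ⟨(N - 1) • walkEffect r + ∑ m ∈ S, (z m).toNat • walkEffect m, ?_, fun i => ?_⟩
    · refine add_mem (nsmul_mem (A.walkEffect_mem_cycleEffects hq hrA) _) (sum_mem fun m hm => ?_)
      obtain ⟨⟨p, hp, hw⟩, -⟩ := (hS m).1 hm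
      exact nsmul_mem (A.walkEffect_mem_cycleEffects hp hw) _
    · have h1 := LinearMap.congr_fun hl (Pi.single i 1)
      simp only [Finset.sum_disjSum, LinearMap.neg_apply, LinearMap.add_apply, LinearMap.sum_apply,
        LinearMap.smul_apply, a, Sum.elim_inl, Sum.elim_inr, dotFunctional_apply, smul_eq_mul,
        LinearMap.proj_apply, Pi.single_apply, mul_ite, mul_one, mul_zero, mul_neg,
        Finset.sum_ite_eq', Finset.mem_univ, if_true, Finset.sum_neg_distrib] at h1
      have h2 := congrArg (fun x => (N : ℚ) * x) h1
      simp only [mul_add, Finset.mul_sum, ← mul_assoc] at h2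
      rw [Finset.sum_congr rfl (g := fun m => ((z m : ℚ) * (walkEffect m i : ℚ)))
        fun m hm => by rw [hz m hm]] at h2
      have h3 : (0 : ℚ) ≤ N * l (.inr i) := mul_nonneg (by positivity) (hl0 _)
      have h4 : (0 : ℚ) ≤ N * (walkEffect r i : ℚ) + ∑ m ∈ S, (z m : ℚ) * (walkEffect m i : ℚ) := by
        linarith
      have h5 : (0 : ℤ) ≤ N * walkEffect r i + ∑ m ∈ S, z m * walkEffect m i := by exact_mod_cast h4
      have h6 : ∑ m ∈ S, ((z m).toNat : ℤ) * walkEffect m i = ∑ m ∈ S, z m * walkEffect m i :=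
        Finset.sum_congr rfl fun m hm => by rw [Int.toNat_of_nonneg (hz0 m hm)]
      simp only [Pi.zero_apply, Pi.add_apply, Finset.sum_apply, Pi.smul_apply, smul_eq_mul,
        ← natCast_zsmul, h6, Nat.cast_pred hN]
      linarith
  · exfalso
    push Not at hfar
    obtain ⟨x, hx, hxr⟩ := hfar
    obtain ⟨N, hN, hc⟩ := exists_common_denominator Finset.univ x
    choose! c hc using hc
    have hdot : ∀ v : Fin d → ℤ, ((∑ i, c i * v i : ℤ) : ℚ) = N * ∑ i, (v i : ℚ) * x i := by
      intro v
      rw [Finset.mul_sum]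
      push_cast
      refine Finset.sum_congr rfl fun i hi => ?_
      rw [← hc i hi]; ring
    have hN' : (0 : ℚ) < N := by exact_mod_cast hN
    have hc0 : ∀ i, 0 ≤ c i := fun i => by
      have h1 := hx (.inr i) (by simp)
      simp only [a, Sum.elim_inr, LinearMap.neg_apply, LinearMap.proj_apply] at h1
      have : (0 : ℚ) ≤ c i := by
        rw [← hc i (Finset.mem_univ i)]; exact mul_nonneg hN'.le (by linarith)
      exact_mod_cast this
    let φ : (Fin d → ℤ) →+ ℤ :=
      { toFun := fun v => ∑ i, c i * v i
        map_zero' := by simp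
        map_add' := fun v w => by simp [mul_add, Finset.sum_add_distrib] }
    obtain ⟨w, hw⟩ := hA.exists_potential φ (closed_walk_weight_nonpos φ fun p hp l hl hlen => by
      have h1 := hx (.inl l) (by simpa using (hS l).2 ⟨⟨p, hp, hl⟩, hlen⟩)
      simp only [a, Sum.elim_inl, dotFunctional_apply] at h1
      have : ((∑ i, c i * walkEffect l i : ℤ) : ℚ) ≤ 0 := by
        rw [hdot]; exact mul_nonpos_of_nonneg_of_nonpos hN'.le h1
      exact_mod_cast this)
    -- The scaled vector `c` with potential `w` must be neutral along `r`, so its weight on `r` is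
    -- zero, not negative.
    have hneu := hf.neutral_of_integral c w hc0 hw
    have h1 := hr.sum_slack ⟨fun i => c i, fun p => w p⟩
    rw [List.map_congr_left (g := fun _ => (0 : ℚ)) fun t ht => by
      have := hneu t (hr.mem t ht)
      rw [sub_eq_zero]
      dsimp only
      exact_mod_cast this] at h1
    have h2 := hdot (walkEffect r)
    push_cast at h2
    simp only [List.map_const', List.sum_replicate, smul_zero, h2, add_sub_cancel_right] at h1
    simp only [LinearMap.neg_apply, dotFunctional_apply] at hxr
    nlinarith

end Compensation

/-! ### Executable walks -/

section Executable

variable {σ : Type*} {d : ℕ}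

/-- All counters stay non-negative when the transitions `l` are taken from the vector `v`. -/
def Executable : List (VTransition σ d) → (Fin d → ℤ) → Prop
  | [], v => 0 ≤ v
  | t :: l, v => 0 ≤ v ∧ Executable l (v + t.2.1)

theorem Executable.nonneg {l : List (VTransition σ d)} {v : Fin d → ℤ} (h : Executable l v) :
    0 ≤ v := by
  cases l with
  | nil => exact h
  | cons t l => exact h.1

theorem executable_append {l m : List (VTransition σ d)} {v : Fin d → ℤ} :
    Executable (l ++ m) v ↔ Executable l v ∧ Executable m (v + walkEffect l) := by
  induction l generalizing v with
  | nil => simpa [Executable] using Executable.nonneg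
  | cons t l ih => simp [Executable, ih, and_assoc, add_assoc]

theorem Executable.mono {l : List (VTransition σ d)} {v w : Fin d → ℤ} (h : Executable l v)
    (hvw : v ≤ w) : Executable l w := by
  induction l generalizing v w with
  | nil => exact le_trans h hvw
  | cons t l ih => exact ⟨h.1.trans hvw, ih h.2 (add_le_add_left hvw _)⟩

theorem abs_walkEffect_le {l : List (VTransition σ d)} {M : ℕ} (hM : ∀ t ∈ l, ∀ i, |t.2.1 i| ≤ M)
    (i : Fin d) : |walkEffect l i| ≤ l.length * M := by
  induction l with
  | nil => simp
  | cons t l ih =>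
    have h1 := ih fun s hs => hM s (by simp [hs])
    have h2 := hM t (by simp) i
    have h3 := abs_add_le (t.2.1 i) (walkEffect l i)
    simp only [walkEffect_cons, Pi.add_apply, List.length_cons]
    push_cast
    linarith

theorem executable_of_length_le {l : List (VTransition σ d)} {M : ℕ}
    (hM : ∀ t ∈ l, ∀ i, |t.2.1 i| ≤ M) {v : Fin d → ℤ} (hv : ∀ i, (l.length * M : ℤ) ≤ v i) :
    Executable l v := by
  induction l generalizing v with
  | nil => exact fun i => by simpa using hv i
  | cons t l ih =>
    refine ⟨fun i => le_trans (by positivity) (hv i), ih (fun s hs => hM s (by simp [hs])) ?_⟩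
    intro i
    have h1 := hv i
    have h2 := neg_le_of_abs_le (hM t (by simp) i)
    simp only [List.length_cons, Pi.add_apply] at h1 ⊢
    push_cast at h1
    linarith

/-- `W` pays for a single round and `D` for the net loss of each round. -/
theorem executable_repeatList {l : List (VTransition σ d)} {W D : ℕ}
    (hl : Executable l fun _ => (W : ℤ)) (hD : ∀ i, -(D : ℤ) ≤ walkEffect l i) (m : ℕ)
    {v : Fin d → ℤ} (hv : ∀ i, (W + m * D : ℤ) ≤ v i) : Executable (repeatList m l) v := by
  induction m generalizing v with
  | zero => exact fun i => le_trans (by positivity) (hv i)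
  | succ m ih =>
    rw [repeatList_succ, executable_append]
    refine ⟨hl.mono fun i => le_trans ?_ (hv i), ih fun i => ?_⟩
    · have : (0 : ℤ) ≤ (m + 1 : ℕ) * D := by positivity
      linarith
    · have h1 := hv i
      have h2 := hD i
      push_cast at h1
      simp only [Pi.add_apply]
      linarith

theorem VASS.exists_abs_le (A : VASS σ d) : ∃ M : ℕ, ∀ t ∈ A.trans, ∀ i, |t.2.1 i| ≤ M := by
  refine ⟨A.trans.sup fun t => Finset.univ.sup fun i => (t.2.1 i).natAbs, fun t ht i => ?_⟩
  rw [Int.abs_eq_natAbs]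
  exact_mod_cast (Finset.le_sup (f := fun i => (t.2.1 i).natAbs) (Finset.mem_univ i)).trans
    (Finset.le_sup (f := fun t : VTransition σ d =>
      Finset.univ.sup fun i => (t.2.1 i).natAbs) ht)

theorem VASS.hasComputation_zero (A : VASS σ d) (c : σ × (Fin d → ℕ)) : A.HasComputation c 0 :=
  ⟨fun _ => c, rfl, fun i => i.elim0⟩

theorem VASS.hasComputation_succ {A : VASS σ d} {c : σ × (Fin d → ℕ)} {n : ℕ} :
    A.HasComputation c (n + 1) ↔ ∃ c', A.Step c c' ∧ A.HasComputation c' n := by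
  constructor
  · rintro ⟨γ, rfl, h⟩
    refine ⟨γ 1, h 0, fun i => γ i.succ, rfl, fun i => ?_⟩
    simpa using h i.succ
  · rintro ⟨c', h, γ, rfl, hγ⟩
    refine ⟨Fin.cons c γ, rfl, fun i => ?_⟩
    refine Fin.cases ?_ (fun i => ?_) i
    · simpa using h
    · simpa [← Fin.succ_castSucc] using hγ i

theorem IsWalk.hasComputation {A : VASS σ d} {p q : σ} {l : List (VTransition σ d)}
    (hl : IsWalk A.trans p l q) {v : Fin d → ℕ} (h : Executable l fun i => (v i : ℤ)) :
    A.HasComputation (p, v) l.length := by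
  induction l generalizing p v with
  | nil => exact A.hasComputation_zero _
  | cons t l ih =>
    obtain ⟨ht, rfl, hl⟩ := hl
    have h0 := h.2.nonneg
    have hv : (fun i => (((v i + t.2.1 i).toNat : ℕ) : ℤ)) = (fun i => (v i : ℤ)) + t.2.1 :=
      funext fun i => Int.toNat_of_nonneg (h0 i)
    exact VASS.hasComputation_succ.2 ⟨(t.2.2, fun i => (v i + t.2.1 i).toNat),
      ⟨t.2.1, ht, fun i => congrFun hv i⟩, ih hl (by rw [hv]; exact h.2)⟩

end Executable

/-! ### Long computations -/

section LowerBound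

variable {σ : Type*} {d : ℕ}

/-- A combination of closed walks can be pumped `n` times by a closed walk of length linear in `n`
through any given state, up to a constant effect of a closed walk. -/
theorem VASS.StronglyConnected.exists_pump {A : VASS σ d} (hA : A.StronglyConnected)
    {e : Fin d → ℤ} (he : e ∈ A.cycleEffects) {q : σ} (hq : q ∈ A.states) :
    ∃ κ, IsWalk A.trans q κ q ∧ ∃ C : ℕ, ∀ n : ℕ, ∃ θ, IsWalk A.trans q θ q ∧
      θ.length ≤ C * (n + 1) ∧ walkEffect θ = walkEffect κ + n • e := by
  induction he using AddSubmonoid.closure_induction with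
  | mem e he =>
    obtain ⟨p, hp, l, hl, rfl⟩ := he
    obtain ⟨m₁, -, h₁⟩ := hA.exists_walk hq hp
    obtain ⟨m₂, -, h₂⟩ := hA.exists_walk hp hq
    -- The constant part is the detour from `q` to `p` and back; only the cycle `l` is repeated.
    refine ⟨m₁ ++ m₂, h₁.append h₂, m₁.length + l.length + m₂.length, fun n =>
      ⟨m₁ ++ (repeatList n l ++ m₂), h₁.append ((hl.repeatList n).append h₂), ?_, ?_⟩⟩
    · simp only [List.length_append, length_repeatList]
      nlinarith [Nat.zero_le (m₁.length * n), Nat.zero_le (m₂.length * n)]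
    · simp only [walkEffect_append, walkEffect_repeatList]
      abel
  | zero => exact ⟨[], rfl, 0, fun n => ⟨[], rfl, by simp, by simp⟩⟩
  | add x y _ _ hx hy =>
    obtain ⟨κ₁, hκ₁, C₁, h₁⟩ := hx
    obtain ⟨κ₂, hκ₂, C₂, h₂⟩ := hy
    refine ⟨κ₁ ++ κ₂, hκ₁.append hκ₂, C₁ + C₂, fun n => ?_⟩
    obtain ⟨θ₁, w₁, l₁, e₁⟩ := h₁ n
    obtain ⟨θ₂, w₂, l₂, e₂⟩ := h₂ n
    refine ⟨θ₁ ++ θ₂, w₁.append w₂, ?_, ?_⟩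
    · simp only [List.length_append]; linarith
    · simp only [walkEffect_append, e₁, e₂, smul_add]; abel

/-- There are closed walks of length at least `n ^ k` which can be executed from counters of size
linear in `n`, and lose at most `n` times the effect of a fixed closed walk. -/
def VASS.HasLongWalks (A : VASS σ d) (k : ℕ) : Prop :=
  ∃ q ∈ A.states, ∃ r, IsWalk A.trans q r q ∧ ∃ C : ℕ, ∀ n : ℕ, ∃ τ, IsWalk A.trans q τ q ∧
    n ^ k ≤ τ.length ∧ Executable τ (fun _ => (C * n : ℕ)) ∧ n • walkEffect r ≤ walkEffect τ

theorem VASS.StronglyConnected.hasLongWalks_one {A : VASS σ d} (hA : A.StronglyConnected) :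
    A.HasLongWalks 1 := by
  obtain ⟨q, hq⟩ := A.states_nonempty
  obtain ⟨r, hne, hr⟩ := hA.exists_walk hq hq
  obtain ⟨M, hM⟩ := A.exists_abs_le
  refine ⟨q, hq, r, hr, r.length * M, fun n => ⟨repeatList n r, hr.repeatList n, ?_, ?_, ?_⟩⟩
  · have := List.length_pos_iff.2 hne
    simp only [pow_one, length_repeatList]
    nlinarith
  · refine executable_of_length_le (fun t ht => hM t ((hr.repeatList n).mem t ht)) fun i => ?_
    simp only [length_repeatList]
    push_cast
    exact le_of_eq (by ring)
  · rw [walkEffect_repeatList]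

/-- Each round runs a long walk of `B` and then a compensation of linear length. Their effects
cancel up to that of `κ`, so linear counters allow `n` rounds. -/
theorem VASS.HasLongWalks.succ {A B : VASS σ d} (hA : A.StronglyConnected) {f : VLinearMap σ d}
    (hf : f.IsMaxQRF A) (hstates : B.states ⊆ A.states) (htrans : B.trans ⊆ f.neutral A) {k : ℕ}
    (hB : B.HasLongWalks k) : A.HasLongWalks (k + 1) := by
  obtain ⟨q, hq, r, hr, C, hτ⟩ := hB
  replace hq := hstates hq
  have hneu : f.neutral A ⊆ A.trans := by
    classical exact Finset.filter_subset _ _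
  have hrA := (hr.mono htrans).mono hneu
  obtain ⟨e, he, hre⟩ := hf.exists_compensation hA hq (hr.mono htrans)
  obtain ⟨κ, hκ, C', hθ⟩ := hA.exists_pump he hq
  obtain ⟨M, hM⟩ := A.exists_abs_le
  -- The summands pay, in order, for executing `τ`, for its loss `n • walkEffect r`, for executing
  -- `θ`, and for the loss of `κ` over `n` rounds.
  refine ⟨q, hq, κ, hκ, C + r.length * M + 2 * C' * M + κ.length * M, fun n => ?_⟩
  -- The estimate `C' * (n + 1) ≤ 2 * C' * n` needs `n ≥ 1`; for `n = 0` the empty walk suffices.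
  rcases Nat.eq_zero_or_pos n with rfl | hn
  · exact ⟨[], rfl, by simp, fun i => by simp, by simp⟩
  obtain ⟨τ, hwτ, hlτ, hxτ, heτ⟩ := hτ n
  obtain ⟨θ, hwθ, hlθ, heθ⟩ := hθ n
  have hround : walkEffect κ ≤ walkEffect (τ ++ θ) := by
    intro i
    have h1 := heτ i
    have h2 := mul_nonneg (Int.natCast_nonneg n) (hre i)
    simp only [walkEffect_append, Pi.add_apply, heθ, ← natCast_zsmul, Pi.smul_apply,
      smul_eq_mul] at h1 h2 ⊢
    rw [mul_add] at h2
    linarith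
  have hw := ((hwτ.mono htrans).mono hneu).append hwθ
  refine ⟨repeatList n (τ ++ θ), hw.repeatList n, ?_, ?_, ?_⟩
  · rw [length_repeatList, pow_succ', List.length_append]
    exact Nat.mul_le_mul_left n (by omega)
  · refine executable_repeatList (W := C * n + r.length * M * n + 2 * C' * M * n)
      (D := κ.length * M) ?_ (fun i => ?_) n fun i => ?_
    · rw [executable_append]
      refine ⟨hxτ.mono fun i => ?_, ?_⟩
      · have : C * n ≤ C * n + r.length * M * n + 2 * C' * M * n := by
          rw [add_assoc]; exact Nat.le_add_right _ _
        exact Int.ofNat_le.2 this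
      refine executable_of_length_le (fun t ht => hM t (hwθ.mem t ht)) fun i => ?_
      have h1 := heτ i
      have h2 := neg_le_of_abs_le (abs_walkEffect_le (fun t ht => hM t (hrA.mem t ht)) i)
      have h3 : θ.length * M ≤ 2 * C' * M * n := by
        calc θ.length * M ≤ C' * (n + 1) * M := Nat.mul_le_mul_right _ hlθ
          _ ≤ C' * (n + n) * M := by gcongr; exact hn
          _ = 2 * C' * M * n := by ring
      have h4 := mul_le_mul_of_nonneg_left h2 (Int.natCast_nonneg n)
      simp only [← natCast_zsmul, Pi.smul_apply, smul_eq_mul, Pi.add_apply] at h1 ⊢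
      zify at h3
      push_cast
      have h5 : (0 : ℤ) ≤ C * n := by positivity
      linarith
    · exact_mod_cast (neg_le_of_abs_le
        (abs_walkEffect_le (fun t ht => hM t (hκ.mem t ht)) i)).trans (hround i)
    · push_cast
      exact le_of_eq (by ring)
  · rw [walkEffect_repeatList]
    exact nsmul_le_nsmul_right hround n

theorem Decompose.hasLongWalks {A : VASS σ d} {K : ℕ∞} (h : Decompose A K)
    (hA : A.StronglyConnected) {k : ℕ} (hk : K = k) : A.HasLongWalks k := by
  induction h generalizing k with
  | infinite A f hf hall => exact absurd hk (by simp)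
  | one A f hf hall hnone =>
    obtain rfl : k = 1 := by exact_mod_cast hk.symm
    exact hA.hasLongWalks_one
  | recurse A f hf hall hnone r hr ih =>
    cases k with
    | zero => simp at hk
    | succ k =>
      rw [Nat.cast_succ, add_comm, ENat.add_left_injective_of_ne_top ENat.one_ne_top |>.eq_iff] at hk
      cases k with
      -- The supremum is `0`, as when the neutral part has no component.
      | zero => exact hA.hasLongWalks_one
      | succ k =>
        -- A finite positive supremum is attained: some `r B` exceeds `k` and cannot exceed `k + 1`.
        have hlt : (k : ℕ∞) < ⨆ (B) (_ : VASS.IsSCC A.states (f.neutral A) B), r B := by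
          rw [hk]; exact_mod_cast Nat.lt_succ_self k
        simp only [lt_iSup_iff] at hlt
        obtain ⟨B, hB, hlt⟩ := hlt
        have hle : r B ≤ (k + 1 : ℕ) := hk ▸ le_iSup₂_of_le B hB le_rfl
        have hrB : r B = (k + 1 : ℕ) := by
          refine le_antisymm hle ?_
          rw [Nat.cast_succ]
          exact Order.add_one_le_of_lt hlt
        exact (ih B hB hB.1.1 hrB).succ hA hf hB.1.2.1 hB.1.2.2

/-- Closed walks as in `VASS.HasLongWalks` bound the termination complexity from below. -/
theorem VASS.HasLongWalks.exists_le_termComplexity {A : VASS σ d} (hd : 0 < d) {k : ℕ}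
    (h : A.HasLongWalks k) :
    ∃ C : ℕ, 0 < C ∧ ∀ n : ℕ, (((n / C) ^ k : ℕ) : ℕ∞) ≤ A.termComplexity n := by
  obtain ⟨q, hq, _, _, C, h⟩ := h
  -- `C + 1` keeps the divisor positive when `C = 0`.
  refine ⟨C + 1, by omega, fun n => ?_⟩
  obtain ⟨τ, hw, hl, hx, -⟩ := h (n / (C + 1))
  have hsize : VASS.size (fun _ : Fin d => n) = n := by
    have : Nonempty (Fin d) := ⟨⟨0, hd⟩⟩
    exact Finset.sup_const Finset.univ_nonempty n
  have hcomp : A.HasComputation (q, fun _ => n) τ.length := hw.hasComputation <| hx.mono fun i => by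
    have : C * (n / (C + 1)) ≤ n :=
      (Nat.mul_le_mul_right _ (Nat.le_succ C)).trans (Nat.mul_div_le n (C + 1))
    exact Int.ofNat_le.2 this
  calc (((n / (C + 1)) ^ k : ℕ) : ℕ∞) ≤ (τ.length : ℕ∞) := by exact_mod_cast hl
    _ ≤ A.maxLength (q, fun _ => n) := le_iSup₂_of_le τ.length hcomp le_rfl
    _ ≤ A.termComplexity n :=
      le_iSup₂_of_le (f := fun c (_ : c.1 ∈ A.states ∧ VASS.size c.2 = n) => A.maxLength c)
        (q, fun _ => n) ⟨hq, hsize⟩ le_rfl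

theorem mem_bigOmega_pow {C k : ℕ} (hC : 0 < C) {L : ℕ → ℕ} (h : ∀ n, (n / C) ^ k ≤ L n) :
    L ∈ bigOmega fun n => n ^ k := by
  -- For `n ≥ C`, rounding down costs at most a factor 2: `n ≤ 2 * C * (n / C)`.
  refine ⟨((2 * C : ℝ) ^ k)⁻¹, by positivity, Filter.eventually_atTop.2 ⟨C, fun n hn => ?_⟩⟩
  have h1 : n ≤ 2 * C * (n / C) := by
    have h2 := Nat.div_add_mod n C
    have h3 := Nat.mod_lt n hC
    have h4 : 1 ≤ n / C := (Nat.one_le_div_iff hC).2 hn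
    nlinarith
  have h2 : n ^ k ≤ (2 * C) ^ k * L n := by
    calc n ^ k ≤ (2 * C * (n / C)) ^ k := Nat.pow_le_pow_left h1 k
      _ = (2 * C) ^ k * (n / C) ^ k := mul_pow _ _ _
      _ ≤ _ := Nat.mul_le_mul_left _ (h n)
  rw [inv_mul_le_iff₀ (by positivity)]
  exact_mod_cast h2

end LowerBound

/-! ### Closed walks and neutral transitions -/

theorem List.eq_zero_of_sum_nonneg_of_nonpos {l : List ℚ} (h : ∀ x ∈ l, x ≤ 0) (hs : 0 ≤ l.sum) :
    ∀ x ∈ l, x = 0 := by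
  induction l with
  | nil => simp
  | cons y l ih =>
    have h1 := h y (by simp)
    have h2 : ∀ x ∈ l, x ≤ 0 := fun x hx => h x (by simp [hx])
    have h3 : l.sum ≤ 0 := by
      simpa using List.sum_le_card_nsmul l 0 h2
    rw [List.sum_cons] at hs
    intro x hx
    rcases List.mem_cons.1 hx with rfl | hx
    · linarith
    · exact ih h2 (by linarith) x hx

section Neutral

variable {σ : Type*} {d : ℕ}

theorem VLinearMap.mem_neutral {f : VLinearMap σ d} {A : VASS σ d} {t : VTransition σ d} :
    t ∈ f.neutral A ↔ t ∈ A.trans ∧ f.Neutral t := by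
  classical simp [VLinearMap.neutral]

theorem VLinearMap.neutral_subset (f : VLinearMap σ d) (A : VASS σ d) :
    f.neutral A ⊆ A.trans := fun _ ht => (VLinearMap.mem_neutral.1 ht).1

theorem VLinearMap.IsQRF.slack_nonpos {f : VLinearMap σ d} {A : VASS σ d} (hf : f.IsQRF A)
    {t : VTransition σ d} (ht : t ∈ A.trans) :
    (∑ i, f.c i * (t.2.1 i : ℚ)) + f.w t.2.2 - f.w t.1 ≤ 0 := by
  rcases hf.2 t ht with h | h
  · have : _ ≤ _ := h
    linarith
  · have : _ = _ := h
    linarith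

/-- A closed walk with non-negative weight has only neutral transitions. -/
theorem VLinearMap.IsQRF.mem_neutral_of_closed {f : VLinearMap σ d} {A : VASS σ d}
    (hf : f.IsQRF A) {p : σ} {l : List (VTransition σ d)} (hl : IsWalk A.trans p l p)
    (h : 0 ≤ ∑ i, f.c i * (walkEffect l i : ℚ)) : ∀ t ∈ l, t ∈ f.neutral A := by
  intro t ht
  have hs := hl.sum_slack f
  have h0 := List.eq_zero_of_sum_nonneg_of_nonpos
    (l := l.map fun t => (∑ i, f.c i * (t.2.1 i : ℚ)) + f.w t.2.2 - f.w t.1) (by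
      intro x hx
      obtain ⟨s, hs, rfl⟩ := List.mem_map.1 hx
      exact hf.slack_nonpos (hl.mem s hs)) (by rw [hs]; linarith) _ (List.mem_map.2 ⟨t, ht, rfl⟩)
  exact VLinearMap.mem_neutral.2 ⟨hl.mem t ht, sub_eq_zero.1 h0⟩

theorem VLinearMap.weight_eq_zero_of_neutral {f : VLinearMap σ d} {A : VASS σ d}
    {p : σ} {l : List (VTransition σ d)} (hl : IsWalk (f.neutral A) p l p) :
    ∑ i, f.c i * (walkEffect l i : ℚ) = 0 := by
  have hs := hl.sum_slack f
  rw [List.map_congr_left (g := fun _ => (0 : ℚ)) fun t ht =>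
    sub_eq_zero.2 (VLinearMap.mem_neutral.1 (hl.mem t ht)).2] at hs
  simp only [List.map_const', List.sum_replicate, smul_zero, add_sub_cancel_right] at hs
  exact hs.symm

/-! ### The depth of the recursion -/

/-- The rational vector space spanned by the effects of the closed walks of `A`. -/
def VASS.cycleSpace (A : VASS σ d) : Submodule ℚ (Fin d → ℚ) :=
  Submodule.span ℚ {x | ∃ p ∈ A.states, ∃ l, IsWalk A.trans p l p ∧
    x = fun i => (walkEffect l i : ℚ)}

/-- By strong connectivity every transition lies on a closed walk, and a closed walk of non-negative
weight is entirely neutral. -/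
theorem VLinearMap.IsQRF.exists_closed_neg {f : VLinearMap σ d} {A : VASS σ d} (hf : f.IsQRF A)
    (hA : A.StronglyConnected) (h : f.neutral A ≠ A.trans) :
    ∃ p ∈ A.states, ∃ l, IsWalk A.trans p l p ∧ ∑ i, f.c i * (walkEffect l i : ℚ) < 0 := by
  by_contra! hc
  refine h (Finset.Subset.antisymm (f.neutral_subset A) fun t ht => ?_)
  obtain ⟨l, -, hl⟩ := hA.exists_walk (A.tgt_mem t ht) (A.src_mem t ht)
  have hw : IsWalk A.trans t.1 (t :: l) t.1 := ⟨ht, rfl, hl⟩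
  exact hf.mem_neutral_of_closed hw (hc _ (A.src_mem t ht) _ hw) t (by simp)

/-- The functional with coefficients `f.c` vanishes on the cycle space of `B` and is negative on
some closed walk of `A`. -/
theorem VASS.cycleSpace_lt {A B : VASS σ d} (hA : A.StronglyConnected) {f : VLinearMap σ d}
    (hf : f.IsQRF A) (h : f.neutral A ≠ A.trans) (hstates : B.states ⊆ A.states)
    (htrans : B.trans ⊆ f.neutral A) : B.cycleSpace < A.cycleSpace := by
  refine lt_of_le_of_ne (Submodule.span_mono ?_) fun heq => ?_
  · rintro _ ⟨p, hp, l, hl, rfl⟩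
    exact ⟨p, hstates hp, l, (hl.mono htrans).mono (f.neutral_subset A), rfl⟩
  · obtain ⟨p, hp, l, hl, hneg⟩ := hf.exists_closed_neg hA h
    have hmem : (fun i => (walkEffect l i : ℚ)) ∈ B.cycleSpace :=
      heq ▸ Submodule.subset_span ⟨p, hp, l, hl, rfl⟩
    have hker : B.cycleSpace ≤ LinearMap.ker (∑ i, f.c i • LinearMap.proj i :
        (Fin d → ℚ) →ₗ[ℚ] ℚ) := by
      refine Submodule.span_le.2 ?_
      rintro _ ⟨q, -, m, hm, rfl⟩
      simpa using VLinearMap.weight_eq_zero_of_neutral (hm.mono htrans)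
    have := hker hmem
    simp only [LinearMap.mem_ker, LinearMap.sum_apply, LinearMap.smul_apply, LinearMap.proj_apply,
      smul_eq_mul] at this
    exact hneg.ne this

theorem VASS.finrank_cycleSpace_pos {A : VASS σ d} (hA : A.StronglyConnected)
    {f : VLinearMap σ d} (hf : f.IsQRF A) (h : f.neutral A ≠ A.trans) :
    0 < Module.finrank ℚ A.cycleSpace := by
  obtain ⟨p, hp, l, hl, hneg⟩ := hf.exists_closed_neg hA h
  refine Module.finrank_pos_iff_exists_ne_zero.2
    ⟨⟨_, Submodule.subset_span ⟨p, hp, l, hl, rfl⟩⟩, fun h0 => ?_⟩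
  have h1 := congrFun (congrArg Subtype.val h0)
  simp only [Submodule.coe_zero, Pi.zero_apply] at h1
  simp [h1] at hneg

/-- Each level of the recursion adds 1 to the result and costs at least one dimension. -/
theorem Decompose.le_finrank {A : VASS σ d} {K : ℕ∞} (h : Decompose A K)
    (hA : A.StronglyConnected) (hK : K ≠ ⊤) : K ≤ Module.finrank ℚ A.cycleSpace := by
  induction h with
  | infinite A f hf hall => exact absurd rfl hK
  | one A f hf hall hnone =>
    exact_mod_cast VASS.finrank_cycleSpace_pos hA hf.1 hall
  | recurse A f hf hall hnone r hr ih =>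
    have hpos := VASS.finrank_cycleSpace_pos hA hf.1 hall
    have hsup : ⨆ (B) (_ : VASS.IsSCC A.states (f.neutral A) B), r B ≤
        ((Module.finrank ℚ A.cycleSpace - 1 : ℕ) : ℕ∞) := by
      refine iSup₂_le fun B hB => ?_
      have hle : r B ≤ ⨆ (B) (_ : VASS.IsSCC A.states (f.neutral A) B), r B :=
        le_iSup₂_of_le B hB le_rfl
      refine (ih B hB hB.1.1 fun htop => hK ?_).trans ?_
      · rw [htop, top_le_iff] at hle
        rw [hle, add_top]
      · have := Submodule.finrank_lt_finrank_of_lt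
          (VASS.cycleSpace_lt hA hf.1 hall hB.1.2.1 hB.1.2.2)
        exact_mod_cast Nat.le_sub_one_of_lt this
    calc _ ≤ 1 + ((Module.finrank ℚ A.cycleSpace - 1 : ℕ) : ℕ∞) := by gcongr
      _ = _ := by rw [← Nat.cast_one, ← Nat.cast_add, Nat.add_sub_cancel' hpos]

theorem Decompose.one_le {A : VASS σ d} {K : ℕ∞} (h : Decompose A K) : 1 ≤ K := by
  cases h with
  | infinite => exact le_top
  | one => exact le_rfl
  | recurse => exact le_self_add

/-! ### Termination -/

theorem IsWalk.source_mem {T : Finset (VTransition σ d)} {p q : σ} {l : List (VTransition σ d)}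
    (hl : IsWalk T p l q) (hne : l ≠ []) : ∃ t ∈ l, t.1 = p := by
  cases l with
  | nil => exact absurd rfl hne
  | cons t l => exact ⟨t, by simp, hl.2.1⟩

open Classical in
/-- The VASS formed by a non-empty closed walk. -/
noncomputable def VASS.ofClosedWalk {T : Finset (VTransition σ d)} {p : σ}
    {l : List (VTransition σ d)} (hl : IsWalk T p l p) (hne : l ≠ []) : VASS σ d where
  states := l.toFinset.image Prod.fst
  trans := l.toFinset
  states_nonempty := by simpa [Finset.image_nonempty, List.toFinset_nonempty_iff] using hne
  src_mem := fun t ht => Finset.mem_image_of_mem _ ht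
  tgt_mem := fun t ht => by
    rw [List.mem_toFinset] at ht
    obtain ⟨l₁, l₂, rfl⟩ := List.append_of_mem ht
    obtain ⟨r, -, -, -, h₂⟩ := isWalk_append.1 hl
    by_cases h0 : l₂ = []
    · subst h0
      obtain rfl : t.2.2 = p := h₂
      obtain ⟨s, hs, he⟩ := hl.source_mem hne
      exact Finset.mem_image.2 ⟨s, List.mem_toFinset.2 hs, he⟩
    · obtain ⟨s, hs, he⟩ := h₂.source_mem h0
      exact Finset.mem_image.2 ⟨s, List.mem_toFinset.2 (by simp [hs]), he⟩
  exists_out := fun q hq => by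
    obtain ⟨t, ht, rfl⟩ := Finset.mem_image.1 hq
    exact ⟨t.2.1, t.2.2, ht⟩

/-- From a transition the walk is followed to its end `p`, then from `p` up to the other transition.
-/
theorem VASS.stronglyConnected_ofClosedWalk {T : Finset (VTransition σ d)} {p : σ}
    {l : List (VTransition σ d)} (hl : IsWalk T p l p) (hne : l ≠ []) :
    (VASS.ofClosedWalk hl hne).StronglyConnected := by
  classical
  intro q hq r hr
  have hw : IsWalk (VASS.ofClosedWalk hl hne).trans p l p :=
    hl.of_mem fun t ht => List.mem_toFinset.2 ht
  obtain ⟨t, ht, rfl⟩ := Finset.mem_image.1 hq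
  obtain ⟨s, hs, rfl⟩ := Finset.mem_image.1 hr
  obtain ⟨l₁, l₂, e₁⟩ := List.append_of_mem (List.mem_toFinset.1 ht)
  obtain ⟨m₁, m₂, e₂⟩ := List.append_of_mem (List.mem_toFinset.1 hs)
  obtain ⟨x, -, h₁⟩ := isWalk_append.1 (congrArg (IsWalk _ p · p) e₁ |>.mp hw)
  obtain ⟨y, h₂, h₃⟩ := isWalk_append.1 (congrArg (IsWalk _ p · p) e₂ |>.mp hw)
  obtain rfl := h₁.2.1
  obtain rfl := h₃.2.1
  exact (h₁.append h₂).transGen (by simp)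

/-- Every strongly connected VASS contained in `(Q, T)` lies in a strongly connected component. -/
theorem VASS.exists_isSCC {Q : Finset σ} {T : Finset (VTransition σ d)} {W : VASS σ d}
    (hW : W.StronglyConnected) (hQ : W.states ⊆ Q) (hT : W.trans ⊆ T) :
    ∃ B, VASS.IsSCC Q T B ∧ W ≤ B := by
  -- A maximal element is obtained by maximizing the bounded number of states plus transitions.
  let S : Set ℕ := {n | ∃ C : VASS σ d, (C.StronglyConnected ∧ C.states ⊆ Q ∧ C.trans ⊆ T) ∧
    W ≤ C ∧ C.states.card + C.trans.card = n}
  have hne : S.Nonempty :=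
    ⟨_, W, ⟨hW, hQ, hT⟩, ⟨Finset.Subset.refl _, Finset.Subset.refl _⟩, rfl⟩
  have hbdd : BddAbove S := by
    refine ⟨Q.card + T.card, ?_⟩
    rintro _ ⟨C, ⟨-, h1, h2⟩, -, rfl⟩
    exact add_le_add (Finset.card_le_card h1) (Finset.card_le_card h2)
  obtain ⟨B, hB, hWB, hcard⟩ := Nat.sSup_mem hne hbdd
  refine ⟨B, ⟨hB, fun C hC hBC => ?_⟩, hWB⟩
  have hle := le_csSup hbdd (a := C.states.card + C.trans.card)
    ⟨C, hC, ⟨hWB.1.trans hBC.1, hWB.2.trans hBC.2⟩, rfl⟩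
  rw [← hcard] at hle
  have h1 := Finset.card_le_card hBC.1
  have h2 := Finset.card_le_card hBC.2
  exact ⟨(Finset.eq_of_subset_of_card_le hBC.1 (by omega)).symm.subset,
    (Finset.eq_of_subset_of_card_le hBC.2 (by omega)).symm.subset⟩

/-- As `f.c ≥ 0`, the walk has non-negative weight, so it is neutral. It therefore survives inside
one component, and the recursion on it can only end with `∞`. -/
theorem Decompose.eq_top_of_closed {A : VASS σ d} {K : ℕ∞} (h : Decompose A K) {p : σ}
    {l : List (VTransition σ d)} (hne : l ≠ []) (hl : IsWalk A.trans p l p)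
    (h0 : 0 ≤ walkEffect l) : K = ⊤ := by
  induction h with
  | infinite => rfl
  | one A f hf hall hnone =>
    obtain ⟨t, ht⟩ := List.exists_mem_of_ne_nil l hne
    have := hf.1.mem_neutral_of_closed hl
      (Finset.sum_nonneg fun i _ => mul_nonneg (hf.1.1 i) (by exact_mod_cast h0 i)) t ht
    simp [hnone] at this
  | recurse A f hf hall hnone r hr ih =>
    have hmem := hf.1.mem_neutral_of_closed hl
      (Finset.sum_nonneg fun i _ => mul_nonneg (hf.1.1 i) (by exact_mod_cast h0 i))
    obtain ⟨B, hB, hle⟩ := VASS.exists_isSCC (Q := A.states) (T := f.neutral A)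
      (VASS.stronglyConnected_ofClosedWalk hl hne) (fun q hq => by
        classical
        obtain ⟨t, ht, rfl⟩ := Finset.mem_image.1 hq
        exact A.src_mem t (hl.mem t (List.mem_toFinset.1 ht)))
      (fun t ht => by
        classical exact hmem t (List.mem_toFinset.1 ht))
    have hrB : r B = ⊤ := ih B hB (hl.of_mem fun t ht => hle.2 (by
      classical exact List.mem_toFinset.2 ht))
    have : ⨆ (B) (_ : VASS.IsSCC A.states (f.neutral A) B), r B = ⊤ :=
      top_le_iff.1 (hrB ▸ le_iSup₂_of_le B hB le_rfl)
    rw [this, add_top]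

theorem VASS.exists_walk_of_steps {A : VASS σ d} {γ : ℕ → σ × (Fin d → ℕ)}
    (hγ : ∀ n, A.Step (γ n) (γ (n + 1))) (i k : ℕ) :
    ∃ l, l.length = k ∧ IsWalk A.trans (γ i).1 l (γ (i + k)).1 ∧
      ∀ j, walkEffect l j = (γ (i + k)).2 j - (γ i).2 j := by
  induction k with
  | zero => exact ⟨[], rfl, rfl, fun j => by simp⟩
  | succ k ih =>
    obtain ⟨l, hlen, hl, he⟩ := ih
    obtain ⟨u, hu, hv⟩ := hγ (i + k)
    refine ⟨l ++ [(_, u, _)], by simp [hlen], hl.append ⟨hu, rfl, rfl⟩, fun j => ?_⟩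
    have := hv j
    simp only [walkEffect_append, walkEffect_cons, walkEffect_nil, Pi.add_apply, he,
      Pi.zero_apply, ← add_assoc, this]
    ring

/-- Without closed walks of non-negative effect there are no infinite computations. -/
theorem VASS.wellFounded_step {A : VASS σ d}
    (h : ∀ p l, l ≠ [] → IsWalk A.trans p l p → ¬ 0 ≤ walkEffect l) :
    WellFounded fun c' c => A.Step c c' := by
  refine wellFounded_iff_isEmpty_descending_chain.2 ⟨fun ⟨γ, hγ⟩ => ?_⟩
  have hst : ∀ n, (γ n).1 ∈ A.states := fun n => by
    obtain ⟨u, hu, -⟩ := hγ n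
    exact A.src_mem _ hu
  -- By Dickson's lemma an infinite computation revisits a state with no counter smaller; the
  -- segment between is a forbidden closed walk.
  have hwqo := (Finite.wellQuasiOrdered (α := A.states) (· = ·)).prod
    (wellQuasiOrdered_le (α := Fin d → ℕ))
  obtain ⟨i, j, hij, h1, h2⟩ := hwqo fun n => (⟨(γ n).1, hst n⟩, (γ n).2)
  obtain ⟨k, rfl⟩ := Nat.exists_eq_add_of_lt hij
  obtain ⟨l, hlen, hl, he⟩ := VASS.exists_walk_of_steps hγ i (k + 1)
  have h1' : (γ i).1 = (γ (i + (k + 1))).1 := congrArg Subtype.val h1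
  rw [← h1'] at hl
  refine h _ l (fun h0 => by simp [h0] at hlen) hl fun m => ?_
  rw [he]
  have := h2 m
  simp only [Pi.zero_apply, sub_nonneg]
  exact_mod_cast this

theorem VASS.finite_steps (A : VASS σ d) (c : σ × (Fin d → ℕ)) : {c' | A.Step c c'}.Finite := by
  refine (A.trans.finite_toSet.image fun t =>
    (t.2.2, fun i => ((c.2 i : ℤ) + t.2.1 i).toNat)).subset ?_
  rintro ⟨q, v⟩ ⟨u, hu, hv⟩
  refine ⟨_, hu, Prod.ext rfl (funext fun i => ?_)⟩
  simp [← hv i]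

/-- König's lemma, as well-founded induction: finitely many successors, each with a bound. -/
theorem VASS.maxLength_ne_top {A : VASS σ d} (h : WellFounded fun c' c => A.Step c c')
    (c : σ × (Fin d → ℕ)) : A.maxLength c ≠ ⊤ := by
  suffices ∃ N : ℕ, ∀ n, A.HasComputation c n → n ≤ N by
    obtain ⟨N, hN⟩ := this
    exact ne_top_of_le_ne_top (ENat.natCast_ne_top N)
      (iSup₂_le fun n hn => by exact_mod_cast hN n hn)
  induction c using h.induction with
  | _ c ih =>
    choose! N hN using ih
    refine ⟨(A.finite_steps c).toFinset.sup N + 1, fun n hn => ?_⟩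
    cases n with
    | zero => omega
    | succ n =>
      obtain ⟨c', hc', hn⟩ := VASS.hasComputation_succ.1 hn
      exact Nat.succ_le_succ ((hN c' hc' n hn).trans
        (Finset.le_sup ((A.finite_steps c).mem_toFinset.2 hc')))

theorem VASS.termComplexity_ne_top {A : VASS σ d} (h : WellFounded fun c' c => A.Step c c')
    (n : ℕ) : A.termComplexity n ≠ ⊤ := by
  have hfin : {c : σ × (Fin d → ℕ) | c.1 ∈ A.states ∧ VASS.size c.2 = n}.Finite := by
    refine (A.states.finite_toSet.prod (Set.finite_Iic fun _ : Fin d => n)).subset ?_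
    rintro ⟨p, v⟩ ⟨hp, hv⟩
    exact ⟨hp, fun i => hv ▸ Finset.le_sup (f := v) (Finset.mem_univ i)⟩
  refine ne_top_of_le_ne_top (b := hfin.toFinset.sup A.maxLength) ?_ (iSup₂_le fun c hc =>
    Finset.le_sup (f := A.maxLength) (hfin.mem_toFinset.2 hc))
  exact ((Finset.sup_lt_iff (by simp)).2
    fun c _ => (VASS.maxLength_ne_top h c).lt_top).ne

end Neutral

theorem mainTheorem1 {σ : Type*} {d : ℕ} (A : VASS σ d) (hA : A.StronglyConnected)
    (k : ℕ) (tight : Bool) (h : AlgReturns A (AlgOutput.bound k tight)) :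
    (1 ≤ k ∧ k ≤ d) ∧
      ∃ L : ℕ → ℕ, (∀ n, A.termComplexity n = (L n : ℕ∞)) ∧ L ∈ bigOmega (fun n => n ^ k) := by
  have hdec : Decompose A k := by
    cases h with
    | bound _ _ _ h => exact h
  have h1 : 1 ≤ k := by exact_mod_cast hdec.one_le
  have hkd : k ≤ d := by
    have h2 : k ≤ Module.finrank ℚ A.cycleSpace := by
      exact_mod_cast hdec.le_finrank hA (ENat.natCast_ne_top k)
    simpa using h2.trans A.cycleSpace.finrank_le
  have hwf := VASS.wellFounded_step fun p l hne hl h0 =>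
    ENat.natCast_ne_top k (hdec.eq_top_of_closed hne hl h0)
  choose L hL using fun n => ENat.ne_top_iff_exists.1 (VASS.termComplexity_ne_top hwf n)
  -- `1 ≤ k ≤ d` gives `0 < d`, without which the constant vector `n` would have size `0`.
  obtain ⟨C, hC, hlow⟩ := (hdec.hasLongWalks hA rfl).exists_le_termComplexity (h1.trans hkd)
  refine ⟨⟨h1, hkd⟩, L, fun n => (hL n).symm, mem_bigOmega_pow hC fun n => ?_⟩
  have := hlow n
  rw [← hL n] at this
  exact_mod_cast this
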